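/- Let $\mathbb F_2$ be the free group on two free generators, and for $n\ge 0$ let $S_n\subset\mathbb F_2$ be the set of elements whose reduced word has length exactly $n$. A subset $T$ of a group $G$ is called right thick if for every finite set $K\subset G$ there is $g\in G$ with $Kg\subset T$. A measured group $(G,\mu)$ is a countable group $G$ together with a probability measure $\mu$ on $G$ whose support generates $G$ as a semigroup. A mean on $G$ is a positive linear functional $\lambda$ on $\ell^\infty(G)$ with $\lambda(1)=1$; it is called left $\mu$-harmonic if $$\sum_{g\in G}\mu(g)\,\lambda\big(\varphi(g^{-1}\,\cdot\,)\big)=\lambda(\varphi)\qquad\text{for all }\varphi\in\ell^\infty(G),$$ and the measure of a set $C\subset G$ with respect to $\lambda$ is $\lambda'(C)=\lambda(\chi_C)$. (1) Suppose $A\subset\mathbb F_2$ satisfies $$\varlimsup_{m\to\infty}\frac1m\sum_{n=1}^m\frac{|A\cap S_n|}{|S_n|}>0.$$ Then there is a finite set $F\subset\mathbb F_2$ such that $FAA^{-1}$ is right thick. (2) Let $(G,\mu)$ be a measured group and let $A\subset G$ be a set with $\lambda'(A)>0$ for some left $\mu$-harmonic mean $\lambda$ on $G$. Then there are a finite set $F\subset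 G$ and a left $\mu$-harmonic mean $\eta$ on $G$ such that $\eta'(FAA^{-1})=1$. -/

import Mathlib

open scoped Pointwise ENNReal

noncomputable section

namespace ProductSets

/-- The sphere of radius `n` in the free group on two generators: all elements whose reduced word
has length exactly `n`. -/
def sphere (n : ℕ) : Set (FreeGroup (Fin 2)) :=
  {x | x.norm = n}

theorem sphere_finite (n : ℕ) : (sphere n).Finite := by
  have h : {l : List (Fin 2 × Bool) | l.length = n}.Finite := List.finite_length_eq _ n
  exact Set.Finite.of_finite_image
    (h.subset (by rintro _ ⟨x, hx, rfl⟩; exact hx)) FreeGroup.toWord_injective.injOn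

/-- The average over the radii `1, …, m` of the proportion of the sphere that lies in `A`. -/
def cesaroSphereAverage (A : Set (FreeGroup (Fin 2))) (m : ℕ) : ℝ :=
  (1 / (m : ℝ)) *
    ∑ n ∈ Finset.Icc 1 m, ((A ∩ sphere n).ncard : ℝ) / ((sphere n).ncard : ℝ)

/-- `A` is large: its upper Cesàro density along spheres is positive. The averages lie in `[0, 1]`,
so the real `limsup` is the usual one. -/
def IsLarge (A : Set (FreeGroup (Fin 2))) : Prop :=
  0 < Filter.limsup (cesaroSphereAverage A) Filter.atTop

section Group

variable {G : Type*} [Group G]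

/-- A subset is right thick if it contains a right translate of every finite set. -/
def IsRightThick (T : Set G) : Prop :=
  ∀ K : Set G, K.Finite → ∃ g : G, (fun x => x * g) '' K ⊆ T

/-- `(G, μ)` is a measured group: the support of `μ` generates `G` as a semigroup. -/
def IsMeasuredGroup (μ : PMF G) : Prop :=
  Subsemigroup.closure μ.support = ⊤

end Group

/-- The space `ℓ^∞(G)` of bounded real functions. -/
abbrev EllInfty (G : Type*) := lp (fun _ : G => ℝ) ∞

/-- The indicator function of a set, as an element of `ℓ^∞(G)`. -/
def indicatorFun {G : Type*} (C : Set G) : EllInfty G :=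
  ⟨C.indicator (fun _ => 1), memℓp_infty ⟨1, by
    classical
    rintro _ ⟨x, rfl⟩
    by_cases h : x ∈ C <;> simp [h]⟩⟩

/-- The left translate `x ↦ φ (g⁻¹ x)`. -/
def leftTranslate {G : Type*} [Group G] (g : G) (φ : EllInfty G) : EllInfty G :=
  ⟨fun x => φ (g⁻¹ * x), memℓp_infty ⟨‖φ‖, by
    rintro _ ⟨x, rfl⟩
    exact lp.norm_apply_le_norm ENNReal.top_ne_zero φ (g⁻¹ * x)⟩⟩

/-- A mean on `G`: a positive unital linear functional on `ℓ^∞(G)`. -/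
structure IsMean {G : Type*} (Λ : EllInfty G →ₗ[ℝ] ℝ) : Prop where
  nonneg : ∀ φ : EllInfty G, (∀ x, 0 ≤ φ x) → 0 ≤ Λ φ
  unital : Λ (indicatorFun Set.univ) = 1

/-- The mean `Λ` is left `μ`-harmonic: the `μ`-average of the values of `Λ` on the left translates
of `φ` is `Λ φ`. -/
structure IsHarmonicMean {G : Type*} [Group G] (μ : PMF G) (Λ : EllInfty G →ₗ[ℝ] ℝ) : Prop where
  isMean : IsMean Λ
  harmonic : ∀ φ : EllInfty G, HasSum (fun g => (μ g).toReal * Λ (leftTranslate g φ)) (Λ φ)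

/-- The finitely additive measure of a set `C` with respect to the mean `Λ`. -/
def meanMeasure {G : Type*} (Λ : EllInfty G →ₗ[ℝ] ℝ) (C : Set G) : ℝ :=
  Λ (indicatorFun C)

end ProductSets

end

open ProductSets

/-! Both parts rest on one fact: if a harmonic mean `Λ` charges `A`, then `FAA⁻¹` is right thick for
some finite `F` (`IsHarmonicMean.exists_isRightThick`). The function `H g = Λ(χ_{gA})` is bounded
and `μ`-harmonic, so a Harnack inequality for `sup H - H` shows that `H` stays near its supremum `s`
on a whole translate `Kx`; hence `{H > s/2}` is right thick. Fewer than `2/s + 1` translates `gA`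
with `H g > s/2` can be pairwise disjoint, so a maximal disjoint family `F` gives `{H > s/2} ⊆
FAA⁻¹`.

For (1), averages over spheres are asymptotically harmonic for the simple random walk, and a limit
along radii where the Cesàro density of `A` stays above a positive constant charges `A`. For (2), a
right thick set has measure 1 for some harmonic mean (`IsRightThick.exists_isHarmonicMean`), by
averaging over iterates of the Markov operator. -/

noncomputable section

namespace ProductSets

open Filter Topology

/-! ### Means and the Markov operator -/

section Means

variable {G : Type*}

theorem indicatorFun_apply_of_mem {C : Set G} {x : G} (h : x ∈ C) :
    (indicatorFun C : EllInfty G) x = 1 :=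
  Set.indicator_of_mem h (fun _ => (1 : ℝ))

theorem indicatorFun_apply_of_notMem {C : Set G} {x : G} (h : x ∉ C) :
    (indicatorFun C : EllInfty G) x = 0 :=
  Set.indicator_of_notMem h (fun _ => (1 : ℝ))

theorem indicatorFun_le_one (C : Set G) (x : G) : (indicatorFun C : EllInfty G) x ≤ 1 := by
  by_cases h : x ∈ C
  · simp [indicatorFun_apply_of_mem h]
  · simp [indicatorFun_apply_of_notMem h]

theorem IsMean.mono {Λ : EllInfty G →ₗ[ℝ] ℝ} (hΛ : IsMean Λ) {φ ψ : EllInfty G}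
    (h : ∀ x, φ x ≤ ψ x) : Λ φ ≤ Λ ψ := by
  have := hΛ.nonneg (ψ - φ) fun x => by simpa using h x
  rw [map_sub] at this
  linarith

theorem IsMean.abs_le_norm {Λ : EllInfty G →ₗ[ℝ] ℝ} (hΛ : IsMean Λ) (φ : EllInfty G) :
    |Λ φ| ≤ ‖φ‖ := by
  have hb : ∀ x, |φ x| ≤ ‖φ‖ := fun x => lp.norm_apply_le_norm ENNReal.top_ne_zero φ x
  have h1 : Λ φ ≤ Λ (‖φ‖ • indicatorFun Set.univ) := hΛ.mono fun x => by
    simpa [indicatorFun_apply_of_mem] using (abs_le.1 (hb x)).2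
  have h2 : Λ ((-‖φ‖) • indicatorFun Set.univ) ≤ Λ φ := hΛ.mono fun x => by
    rw [lp.coeFn_smul, Pi.smul_apply, indicatorFun_apply_of_mem (Set.mem_univ x), smul_eq_mul,
      mul_one]
    exact (abs_le.1 (hb x)).1
  rw [map_smul, hΛ.unital, smul_eq_mul, mul_one] at h1 h2
  exact abs_le.2 ⟨h2, h1⟩

/-- A mean as a continuous functional. -/
def IsMean.toCLM {Λ : EllInfty G →ₗ[ℝ] ℝ} (hΛ : IsMean Λ) : EllInfty G →L[ℝ] ℝ :=
  Λ.mkContinuous 1 fun φ => by simpa using hΛ.abs_le_norm φ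

/-- Evaluation at a point. -/
def pointMean (x : G) : EllInfty G →ₗ[ℝ] ℝ where
  toFun := fun φ => φ x
  map_add' _ _ := rfl
  map_smul' _ _ := rfl

theorem isMean_pointMean (x : G) : IsMean (pointMean x) where
  nonneg _ h := h x
  unital := indicatorFun_apply_of_mem (Set.mem_univ x)

/-- Limits of means along ultrafilters are means. -/
theorem exists_isMean_tendsto {ι : Type*} (U : Ultrafilter ι) (M : ι → EllInfty G →ₗ[ℝ] ℝ)
    (hM : ∀ᶠ i in (U : Filter ι), IsMean (M i)) :
    ∃ Λ : EllInfty G →ₗ[ℝ] ℝ, IsMean Λ ∧ ∀ φ, Tendsto (fun i => M i φ) U (𝓝 (Λ φ)) := by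
  have hex : ∀ φ, ∃ a, Tendsto (fun i => M i φ) U (𝓝 a) := fun φ => by
    obtain ⟨a, -, ha⟩ := (isCompact_Icc (a := -‖φ‖) (b := ‖φ‖)).ultrafilter_le_nhds
      (U.map fun i => M i φ) (by
        rw [le_principal_iff]
        exact hM.mono fun i hi => abs_le.1 (hi.abs_le_norm φ))
    exact ⟨a, ha⟩
  choose L hL using hex
  refine ⟨⟨⟨L, fun φ ψ => ?_⟩, fun c φ => ?_⟩, ⟨fun φ h => ?_, ?_⟩, hL⟩
  · refine tendsto_nhds_unique (hL (φ + ψ)) ?_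
    simpa using (hL φ).add (hL ψ)
  · refine tendsto_nhds_unique (hL (c • φ)) ?_
    simpa using (hL φ).const_mul c
  · refine ge_of_tendsto (hL φ) ?_
    filter_upwards [hM] with i hi using hi.nonneg φ h
  · refine tendsto_nhds_unique (hL _) (tendsto_const_nhds.congr' ?_)
    filter_upwards [hM] with i hi using hi.unital.symm

/-- Averages of means are means. -/
theorem isMean_average {ι : Type*} {s : Finset ι} (hs : s.Nonempty)
    {M : ι → EllInfty G →ₗ[ℝ] ℝ} (hM : ∀ i ∈ s, IsMean (M i)) :
    IsMean ((s.card : ℝ)⁻¹ • ∑ i ∈ s, M i) where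
  nonneg φ h := by
    simp only [LinearMap.smul_apply, LinearMap.sum_apply, smul_eq_mul]
    exact mul_nonneg (by positivity) (Finset.sum_nonneg fun i hi => (hM i hi).nonneg φ h)
  unital := by
    simp only [LinearMap.smul_apply, LinearMap.sum_apply, smul_eq_mul]
    rw [Finset.sum_congr rfl fun i hi => (hM i hi).unital]
    have : (s.card : ℝ) ≠ 0 := by exact_mod_cast hs.card_pos.ne'
    simp [this]

theorem hasSum_toReal (μ : PMF G) : HasSum (fun g => (μ g).toReal) 1 := by
  have h := ENNReal.hasSum_toReal (f := μ) (by simp [μ.tsum_coe])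
  simpa [← ENNReal.tsum_toReal_eq (fun g => μ.apply_ne_top g), μ.tsum_coe] using h

variable [Group G]

@[simp]
theorem leftTranslate_apply (g : G) (φ : EllInfty G) (x : G) :
    leftTranslate g φ x = φ (g⁻¹ * x) := rfl

theorem leftTranslate_add (g : G) (φ ψ : EllInfty G) :
    leftTranslate g (φ + ψ) = leftTranslate g φ + leftTranslate g ψ := rfl

theorem leftTranslate_smul (g : G) (c : ℝ) (φ : EllInfty G) :
    leftTranslate g (c • φ) = c • leftTranslate g φ := rfl

theorem leftTranslate_leftTranslate (g h : G) (φ : EllInfty G) :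
    leftTranslate g (leftTranslate h φ) = leftTranslate (g * h) φ := by
  ext x
  simp [mul_assoc]

theorem leftTranslate_one (φ : EllInfty G) : leftTranslate 1 φ = φ := by
  ext x
  simp

theorem leftTranslate_univ (g : G) :
    leftTranslate g (indicatorFun (Set.univ : Set G)) = indicatorFun Set.univ := by
  ext x
  simp [indicatorFun_apply_of_mem]

theorem norm_leftTranslate_le (g : G) (φ : EllInfty G) : ‖leftTranslate g φ‖ ≤ ‖φ‖ :=
  lp.norm_le_of_forall_le (norm_nonneg _)
    fun x => lp.norm_apply_le_norm ENNReal.top_ne_zero φ (g⁻¹ * x)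

theorem summable_leftTranslate (μ : PMF G) (φ : EllInfty G) :
    Summable fun g => (μ g).toReal • leftTranslate g φ := by
  refine Summable.of_norm_bounded ((hasSum_toReal μ).summable.mul_right ‖φ‖) fun g => ?_
  rw [norm_smul, Real.norm_of_nonneg ENNReal.toReal_nonneg]
  exact mul_le_mul_of_nonneg_left (norm_leftTranslate_le g φ) ENNReal.toReal_nonneg

/-- The Markov operator averaging left translates with respect to `μ`. -/
def markovOp (μ : PMF G) : EllInfty G →ₗ[ℝ] EllInfty G where
  toFun φ := ∑' g, (μ g).toReal • leftTranslate g φ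
  map_add' φ ψ := by
    simp only [leftTranslate_add, smul_add]
    exact (summable_leftTranslate μ φ).tsum_add (summable_leftTranslate μ ψ)
  map_smul' c φ := by
    simp only [leftTranslate_smul, smul_comm _ c, RingHom.id_apply]
    exact (summable_leftTranslate μ φ).tsum_const_smul c

/-- The series defining `markovOp` converges in norm and means are norm continuous, so harmonicity
becomes invariance under `markovOp`. -/
theorem IsMean.hasSum_markovOp {Λ : EllInfty G →ₗ[ℝ] ℝ} (hΛ : IsMean Λ) (μ : PMF G)
    (φ : EllInfty G) :
    HasSum (fun g => (μ g).toReal * Λ (leftTranslate g φ)) (Λ (markovOp μ φ)) := by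
  simpa [Function.comp_def, IsMean.toCLM, markovOp] using
    (hΛ.toCLM).hasSum (summable_leftTranslate μ φ).hasSum

theorem IsMean.isHarmonicMean {Λ : EllInfty G →ₗ[ℝ] ℝ} (hΛ : IsMean Λ) {μ : PMF G}
    (h : ∀ φ, Λ (markovOp μ φ) = Λ φ) : IsHarmonicMean μ Λ :=
  ⟨hΛ, fun φ => h φ ▸ hΛ.hasSum_markovOp μ φ⟩

theorem IsMean.comp_markovOp {Λ : EllInfty G →ₗ[ℝ] ℝ} (hΛ : IsMean Λ) (μ : PMF G) :
    IsMean (Λ ∘ₗ markovOp μ) where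
  nonneg φ h := by
    have hg : ∀ g, 0 ≤ Λ (leftTranslate g φ) := fun g => hΛ.nonneg _ fun x => h (g⁻¹ * x)
    exact (hΛ.hasSum_markovOp μ φ).nonneg fun g => mul_nonneg ENNReal.toReal_nonneg (hg g)
  unital := by
    refine (hΛ.hasSum_markovOp μ _).unique ?_
    simpa [leftTranslate_univ, hΛ.unital] using hasSum_toReal μ

end Means

/-! ### Right thick sets and harmonic means -/

section Thick

variable {G : Type*} [Group G]

theorem IsRightThick.mono {S T : Set G} (hS : IsRightThick S) (h : S ⊆ T) : IsRightThick T :=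
  fun K hK => (hS K hK).imp fun _ hg => hg.trans h

theorem IsRightThick.exists_isMean {T : Set G} (hT : IsRightThick T) :
    ∃ Λ : EllInfty G →ₗ[ℝ] ℝ, IsMean Λ ∧ ∀ g, Λ (leftTranslate g (indicatorFun T)) = 1 := by
  choose c hc using fun K : Finset G => hT K K.finite_toSet
  obtain ⟨Λ, hΛ, hlim⟩ := exists_isMean_tendsto (Ultrafilter.of (atTop : Filter (Finset G)))
    (fun K => pointMean (c K)) (Eventually.of_forall fun K => isMean_pointMean _)
  refine ⟨Λ, hΛ, fun g => tendsto_nhds_unique (hlim _) (tendsto_const_nhds.congr' ?_)⟩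
  -- Once `g⁻¹ ∈ K`, the point `g⁻¹ * c K` lies in `T`.
  filter_upwards [Ultrafilter.of_le (atTop : Filter (Finset G)) (mem_atTop {g⁻¹})] with K hK
  exact (indicatorFun_apply_of_mem (hc K ⟨g⁻¹, hK (by simp), rfl⟩)).symm

theorem IsRightThick.exists_isHarmonicMean {T : Set G} (hT : IsRightThick T) (μ : PMF G) :
    ∃ Λ : EllInfty G →ₗ[ℝ] ℝ, IsHarmonicMean μ Λ ∧ meanMeasure Λ T = 1 := by
  obtain ⟨m, hm, hmT⟩ := hT.exists_isMean
  let M : ℕ → EllInfty G →ₗ[ℝ] ℝ := fun n => m ∘ₗ (markovOp μ) ^ n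
  have hsucc : ∀ n, M (n + 1) = M n ∘ₗ markovOp μ := fun n => by
    ext φ; simp [M, pow_succ]
  have hM : ∀ n, IsMean (M n) := fun n => by
    induction n with
    | zero => exact hm
    | succ n ih => rw [hsucc]; exact ih.comp_markovOp μ
  -- All translates are carried along, since `markovOp` mixes them.
  have hMT : ∀ n g, M n (leftTranslate g (indicatorFun T)) = 1 := fun n => by
    induction n with
    | zero => simpa [M] using hmT
    | succ n ih =>
      intro g
      rw [hsucc]
      refine ((hM n).hasSum_markovOp μ _).unique ?_
      simpa [leftTranslate_leftTranslate, ih] using hasSum_toReal μ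
  obtain ⟨Λ, hΛ, hlim⟩ := exists_isMean_tendsto (Ultrafilter.of (atTop : Filter ℕ))
    (fun n => ((Finset.range (n + 1)).card : ℝ)⁻¹ • ∑ k ∈ Finset.range (n + 1), M k)
    (Eventually.of_forall fun n => isMean_average (by simp) fun k _ => hM k)
  refine ⟨Λ, hΛ.isHarmonicMean fun φ => ?_, ?_⟩
  · rw [← sub_eq_zero]
    refine tendsto_nhds_unique ((hlim (markovOp μ φ)).sub (hlim φ)) ?_
    refine Tendsto.mono_left ?_ (Ultrafilter.of_le (atTop : Filter ℕ))
    have h0 : Tendsto (fun n : ℕ => (2 * ‖φ‖) / ((n : ℝ) + 1)) atTop (𝓝 0) := by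
      simpa [div_eq_mul_inv] using
        (tendsto_one_div_add_atTop_nhds_zero_nat (𝕜 := ℝ)).const_mul (2 * ‖φ‖)
    refine squeeze_zero_norm (fun n => ?_) h0
    have htel : ∑ k ∈ Finset.range (n + 1), M k (markovOp μ φ)
        - ∑ k ∈ Finset.range (n + 1), M k φ = M (n + 1) φ - M 0 φ := by
      rw [← Finset.sum_sub_distrib, ← Finset.sum_range_sub (fun k => M k φ)]
      simp [hsucc]
    have h1 := abs_le.1 ((hM (n + 1)).abs_le_norm φ)
    have h2 := abs_le.1 ((hM 0).abs_le_norm φ)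
    simp only [LinearMap.smul_apply, LinearMap.sum_apply, smul_eq_mul, Finset.card_range]
    rw [← mul_sub, htel, Real.norm_eq_abs, abs_mul, abs_inv, inv_mul_eq_div,
      Nat.cast_add_one, abs_of_pos (by positivity : (0 : ℝ) < n + 1)]
    gcongr
    exact abs_le.2 ⟨by linarith, by linarith⟩
  · refine tendsto_nhds_unique (hlim _) (tendsto_const_nhds.congr fun n => ?_)
    have h1 : ∀ k, M k (indicatorFun T) = 1 := fun k => by
      simpa [leftTranslate_one] using hMT k 1
    simp only [LinearMap.smul_apply, LinearMap.sum_apply, smul_eq_mul, h1]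
    have : (n : ℝ) + 1 ≠ 0 := by positivity
    simp [this]

/-- Either `FAA⁻¹` covers `B` for a finite set `F`, or `B` contains arbitrarily many elements by
which the translates of `A` are disjoint. -/
theorem exists_cover_or_exists_disjoint {A : Set G} (hA : A.Nonempty) (B : Set G) (n : ℕ) :
    (∃ F : Finset G, B ⊆ (F : Set G) * A * A⁻¹) ∨
      ∃ F : Finset G, F.card = n ∧ (F : Set G) ⊆ B ∧
        ∀ x ∈ F, ∀ y ∈ F, ∀ a ∈ A, ∀ a' ∈ A, x * a = y * a' → x = y := by
  classical
  induction n with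
  | zero => exact .inr ⟨∅, by simp⟩
  | succ n ih =>
    obtain h | ⟨F, hcard, hFB, hF⟩ := ih
    · exact .inl h
    by_cases hB : B ⊆ (F : Set G) * A * A⁻¹
    · exact .inl ⟨F, hB⟩
    obtain ⟨b, hb, hbF⟩ := Set.not_subset.1 hB
    -- Otherwise `b = y * a' * a⁻¹` would be covered by `FAA⁻¹`.
    have hkey : ∀ y ∈ F, ∀ a ∈ A, ∀ a' ∈ A, b * a ≠ y * a' := fun y hy a ha a' ha' h => hbF <| by
      refine ⟨y * a', ⟨y, hy, a', ha', rfl⟩, a⁻¹, by simpa using ha, ?_⟩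
      simp [← h]
    have hbF' : b ∉ F := fun h => by
      obtain ⟨a, ha⟩ := hA
      exact hkey b h a ha a ha rfl
    refine .inr ⟨insert b F, by rw [Finset.card_insert_of_notMem hbF', hcard], ?_, ?_⟩
    · rw [Finset.coe_insert]; exact Set.insert_subset hb hFB
    · intro x hx y hy a ha a' ha' h
      rw [Finset.mem_insert] at hx hy
      obtain rfl | hx := hx <;> obtain rfl | hy := hy
      · rfl
      · exact absurd h (hkey y hy a ha a' ha')
      · exact absurd h.symm (hkey x hx a' ha' a ha)
      · exact hF x hx y hy a ha a' ha' h

theorem IsHarmonicMean.exists_isRightThick {μ : PMF G} (hμ : IsMeasuredGroup μ)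
    {Λ : EllInfty G →ₗ[ℝ] ℝ} (hΛ : IsHarmonicMean μ Λ) {A : Set G} (hA : 0 < meanMeasure Λ A) :
    ∃ F : Finset G, IsRightThick ((F : Set G) * A * A⁻¹) := by
  set H : G → ℝ := fun g => Λ (leftTranslate g (indicatorFun A)) with hH
  have hH1 : ∀ g, H g ≤ 1 := fun g => by
    rw [← hΛ.isMean.unital]
    exact hΛ.isMean.mono fun x => by
      rw [indicatorFun_apply_of_mem (Set.mem_univ x)]
      exact indicatorFun_le_one A _
  have hbdd : BddAbove (Set.range H) := ⟨1, by rintro _ ⟨g, rfl⟩; exact hH1 g⟩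
  set s := ⨆ g, H g with hs
  have hle : ∀ g, H g ≤ s := le_ciSup hbdd
  have hspos : 0 < s := lt_of_lt_of_le hA (by simpa [hH, leftTranslate_one, meanMeasure] using hle 1)
  have hsum : ∀ x, HasSum (fun g => (μ g).toReal * (s - H (g * x))) (s - H x) := fun x => by
    have h := hΛ.harmonic (leftTranslate x (indicatorFun A))
    simp only [leftTranslate_leftTranslate] at h
    simpa [mul_sub, hH] using ((hasSum_toReal μ).mul_right s).sub h
  -- Harnack inequality: for `k` in the support, one term of a nonnegative series is at most its
  -- sum; constants multiply along products.
  have hcomp : ∀ k, ∃ C : ℝ, 0 ≤ C ∧ ∀ x, s - H (k * x) ≤ C * (s - H x) := fun k => by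
    have hk : k ∈ Subsemigroup.closure μ.support := by
      rw [show Subsemigroup.closure μ.support = ⊤ from hμ]; trivial
    induction hk using Subsemigroup.closure_induction with
    | mem k hk =>
      have hpos : 0 < (μ k).toReal :=
        ENNReal.toReal_pos ((μ.mem_support_iff k).1 hk) (μ.apply_ne_top k)
      refine ⟨((μ k).toReal)⁻¹, by positivity, fun x => ?_⟩
      rw [inv_mul_eq_div, le_div_iff₀' hpos]
      exact le_hasSum (hsum x) k fun g _ =>
        mul_nonneg ENNReal.toReal_nonneg (sub_nonneg.2 (hle _))
    | mul k l _ _ hk hl =>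
      obtain ⟨C, hC, hk⟩ := hk
      obtain ⟨D, hD, hl⟩ := hl
      refine ⟨C * D, mul_nonneg hC hD, fun x => ?_⟩
      rw [mul_assoc k l x, mul_assoc C D]
      exact (hk _).trans (mul_le_mul_of_nonneg_left (hl x) hC)
  choose C hC0 hC using hcomp
  have hthick : IsRightThick {g | s / 2 < H g} := fun K hK => by
    set D := ∑ k ∈ hK.toFinset, C k with hD
    have hD0 : 0 ≤ D := Finset.sum_nonneg fun k _ => hC0 k
    -- The gap is chosen so that `D` times it is below `s / 2`; the `+ 1` covers `D = 0`.
    have hlt : s - s / (2 * (D + 1)) < s := by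
      have : 0 < s / (2 * (D + 1)) := by positivity
      linarith
    obtain ⟨x, hx⟩ := exists_lt_of_lt_ciSup hlt
    refine ⟨x, ?_⟩
    rintro _ ⟨k, hk, rfl⟩
    have hCD : C k ≤ D := Finset.single_le_sum (fun k _ => hC0 k) (hK.mem_toFinset.2 hk)
    have h1 : s - H (k * x) ≤ D * (s - H x) :=
      (hC k x).trans (mul_le_mul_of_nonneg_right hCD (sub_nonneg.2 (hle x)))
    have h2 : D * (s - H x) ≤ D * (s / (2 * (D + 1))) :=
      mul_le_mul_of_nonneg_left (by linarith) hD0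
    have h3 : D * (s / (2 * (D + 1))) < s / 2 := by
      rw [← mul_div_assoc, div_lt_div_iff₀ (by positivity) (by positivity)]
      nlinarith
    show s / 2 < H (k * x)
    linarith
  have hAne : A.Nonempty := by
    rw [Set.nonempty_iff_ne_empty]
    rintro rfl
    have h0 : (indicatorFun ∅ : EllInfty G) = 0 := by
      ext x
      exact indicatorFun_apply_of_notMem (Set.notMem_empty x)
    simp [meanMeasure, h0] at hA
  obtain ⟨n, hn⟩ := exists_nat_gt (2 / s)
  obtain ⟨F, hF⟩ | ⟨F, hcard, hFB, hF⟩ :=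
    exists_cover_or_exists_disjoint hAne {g | s / 2 < H g} n
  · exact ⟨F, hthick.mono hF⟩
  exfalso
  have h1 : (n : ℝ) * (s / 2) ≤ ∑ g ∈ F, H g := by
    rw [← hcard, ← nsmul_eq_mul]
    exact Finset.card_nsmul_le_sum _ _ _ fun g hg => (hFB hg).le
  have h2 : ∑ g ∈ F, H g ≤ 1 := by
    rw [← hΛ.isMean.unital, hH, ← map_sum]
    refine hΛ.isMean.mono fun x => ?_
    rw [indicatorFun_apply_of_mem (Set.mem_univ x), lp.coeFn_sum, Finset.sum_apply]
    by_cases hx : ∃ g ∈ F, g⁻¹ * x ∈ A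
    · obtain ⟨g, hg, hgx⟩ := hx
      rw [Finset.sum_eq_single_of_mem g hg]
      · exact indicatorFun_le_one A _
      · intro g' hg' hne
        exact indicatorFun_apply_of_notMem fun hx' =>
          hne (hF g' hg' g hg _ hx' _ hgx (by simp))
    · push Not at hx
      refine (Finset.sum_eq_zero fun g hg => ?_).trans_le zero_le_one
      exact indicatorFun_apply_of_notMem (hx g hg)
  rw [div_lt_iff₀ hspos] at hn
  linarith

end Thick

/-! ### Sphere averages in the free group -/

section FreeGroup

/-- The element of the free group given by a single letter. -/
def letter (p : Fin 2 × Bool) : FreeGroup (Fin 2) := FreeGroup.mk [p]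

/-- The inverse letter. -/
def invLetter : Fin 2 × Bool ≃ Fin 2 × Bool :=
  Equiv.prodCongr (Equiv.refl _) Equiv.boolNot

theorem letter_inv (p : Fin 2 × Bool) : (letter p)⁻¹ = letter (invLetter p) := rfl

theorem letter_injective : Function.Injective letter := fun p q h => by
  have := congrArg FreeGroup.toWord h
  simpa [letter, FreeGroup.toWord_mk, FreeGroup.reduce.cons] using this

theorem closure_range_letter : Subsemigroup.closure (Set.range letter) = ⊤ := by
  have hmem : ∀ p, letter p ∈ Subsemigroup.closure (Set.range letter) := fun p =>
    Subsemigroup.subset_closure ⟨p, rfl⟩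
  have hone : (1 : FreeGroup (Fin 2)) ∈ Subsemigroup.closure (Set.range letter) := by
    have h := mul_mem (hmem (0, true)) (hmem (invLetter (0, true)))
    rwa [← letter_inv, mul_inv_cancel] at h
  rw [eq_top_iff]
  rintro x -
  rw [← FreeGroup.mk_toWord (x := x)]
  induction x.toWord with
  | nil => exact hone
  | cons p L ih => exact mul_mem (hmem p) ih

/-- Multiplying by a letter on the left lowers the length by one if the letter cancels, and raises
it by one otherwise. -/
theorem norm_letter_mul {y : FreeGroup (Fin 2)} {n : ℕ} (hy : y.norm = n + 1) :
    ∃ q, ∀ p, (letter p * y).norm = if p = q then n else n + 2 := by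
  obtain ⟨hd, tl, hw⟩ : ∃ hd tl, y.toWord = hd :: tl := by
    cases h : y.toWord with
    | nil => simp [FreeGroup.norm, h] at hy
    | cons hd tl => exact ⟨hd, tl, rfl⟩
  have hlen : tl.length = n := by simpa [FreeGroup.norm, hw] using hy
  have hred : FreeGroup.reduce (hd :: tl) = hd :: tl := hw ▸ FreeGroup.reduce_toWord y
  refine ⟨invLetter hd, fun p => ?_⟩
  have hmul : letter p * y = FreeGroup.mk (p :: hd :: tl) := by
    rw [← hw]
    conv_lhs => rw [← FreeGroup.mk_toWord (x := y)]
    rfl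
  have hiff : (p.1 = hd.1 ∧ p.2 = !hd.2) ↔ p = invLetter hd := by
    rw [Prod.ext_iff]; rfl
  rw [hmul, FreeGroup.norm, FreeGroup.toWord_mk, FreeGroup.reduce.cons, hred]
  simp only [hiff]
  split_ifs <;> simp [hlen]

/-- The sphere of radius `n` as a finite set. -/
def sph (n : ℕ) : Finset (FreeGroup (Fin 2)) := (sphere_finite n).toFinset

theorem mem_sph {n : ℕ} {x : FreeGroup (Fin 2)} : x ∈ sph n ↔ x.norm = n :=
  (sphere_finite n).mem_toFinset

theorem sph_nonempty (n : ℕ) : (sph n).Nonempty :=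
  (FreeGroup.norm_surjective n).imp fun _ h => mem_sph.2 h

theorem card_sph_pos (n : ℕ) : (0 : ℝ) < (sph n).card := by
  exact_mod_cast (sph_nonempty n).card_pos

theorem sum_sph_filter_translate (g : FreeGroup (Fin 2)) (n m : ℕ)
    (f : FreeGroup (Fin 2) → ℝ) :
    ∑ x ∈ sph n with (g⁻¹ * x).norm = m, f (g⁻¹ * x) = ∑ y ∈ sph m with (g * y).norm = n, f y := by
  refine Finset.sum_nbij' (fun x => g⁻¹ * x) (fun y => g * y) ?_ ?_ ?_ ?_ ?_ <;>
    simp +contextual [mem_sph]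

theorem sum_letter_sum_sph_down (n : ℕ) (f : FreeGroup (Fin 2) → ℝ) :
    ∑ p, ∑ y ∈ sph (n + 1) with (letter p * y).norm = n, f y = ∑ y ∈ sph (n + 1), f y := by
  simp only [Finset.sum_filter]
  rw [Finset.sum_comm]
  refine Finset.sum_congr rfl fun y hy => ?_
  obtain ⟨q, hq⟩ := norm_letter_mul (mem_sph.1 hy)
  rw [Finset.sum_eq_single q]
  · simp [hq]
  · intro p _ hp
    simp [hq, hp]
  · simp

theorem sum_letter_sum_sph_up (n : ℕ) (f : FreeGroup (Fin 2) → ℝ) :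
    ∑ p, ∑ y ∈ sph (n + 1) with (letter p * y).norm = n + 2, f y
      = 3 * ∑ y ∈ sph (n + 1), f y := by
  simp only [Finset.sum_filter]
  rw [Finset.sum_comm, Finset.mul_sum]
  refine Finset.sum_congr rfl fun y hy => ?_
  obtain ⟨q, hq⟩ := norm_letter_mul (mem_sph.1 hy)
  have h : ∀ p, (if (letter p * y).norm = n + 2 then f y else 0)
      = f y - if p = q then f y else 0 := fun p => by
    rw [hq]
    by_cases hp : p = q <;> simp [hp]
  simp only [h, Finset.sum_sub_distrib]
  simp
  ring

/-- Double counting: inverting the letter matches steps up from one sphere with steps down from the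
next. Radius 0 is excluded, as all four letters lead up from the identity. -/
theorem card_sph_succ (n : ℕ) : ((sph (n + 2)).card : ℝ) = 3 * (sph (n + 1)).card := by
  have h1 := sum_letter_sum_sph_up n fun _ => 1
  have h2 := sum_letter_sum_sph_down (n + 1) fun _ => 1
  rw [Finset.sum_const, nsmul_one] at h1 h2
  rw [← h1, ← h2, ← invLetter.sum_comp]
  refine Finset.sum_congr rfl fun p _ => ?_
  rw [← sum_sph_filter_translate (letter (invLetter p)) (n + 1) (n + 2) fun _ => 1,
    letter_inv, show invLetter (invLetter p) = p from Prod.ext rfl (Bool.not_not _)]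

theorem sum_letter_sum_sph_translate (n : ℕ) (f : FreeGroup (Fin 2) → ℝ) :
    ∑ p, ∑ x ∈ sph (n + 2), f ((letter p)⁻¹ * x)
      = ∑ y ∈ sph (n + 3), f y + 3 * ∑ y ∈ sph (n + 1), f y := by
  rw [← sum_letter_sum_sph_down (n + 2), ← sum_letter_sum_sph_up n, ← Finset.sum_add_distrib]
  refine Finset.sum_congr rfl fun p _ => ?_
  rw [← sum_sph_filter_translate (letter p), ← sum_sph_filter_translate (letter p),
    ← Finset.sum_filter_add_sum_filter_not (sph (n + 2))
      (fun x => ((letter p)⁻¹ * x).norm = n + 3)]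
  congr 2
  refine Finset.filter_congr fun x hx => ?_
  obtain ⟨q, hq⟩ := norm_letter_mul (mem_sph.1 hx)
  rw [letter_inv, hq]
  split_ifs <;> simp

/-- The mean over the sphere of radius `n`. -/
def sphereMean (n : ℕ) : EllInfty (FreeGroup (Fin 2)) →ₗ[ℝ] ℝ :=
  ((sph n).card : ℝ)⁻¹ • ∑ x ∈ sph n, pointMean x

theorem isMean_sphereMean (n : ℕ) : IsMean (sphereMean n) :=
  isMean_average (sph_nonempty n) fun x _ => isMean_pointMean x

theorem sphereMean_apply (n : ℕ) (φ : EllInfty (FreeGroup (Fin 2))) :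
    sphereMean n φ = ((sph n).card : ℝ)⁻¹ * ∑ x ∈ sph n, φ x := by
  simp only [sphereMean, LinearMap.smul_apply, LinearMap.sum_apply, smul_eq_mul]
  rfl

theorem sphereMean_indicatorFun (n : ℕ) (A : Set (FreeGroup (Fin 2))) :
    sphereMean n (indicatorFun A) = ((A ∩ sphere n).ncard : ℝ) / ((sphere n).ncard : ℝ) := by
  classical
  have h1 : (sphere n).ncard = (sph n).card := Set.ncard_eq_toFinset_card _ (sphere_finite n)
  have h2 : (A ∩ sphere n).ncard = ((sph n).filter (· ∈ A)).card := by
    rw [← Set.ncard_coe_finset]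
    congr 1
    ext x
    simp [mem_sph, sphere, and_comm]
  have h3 : ∑ x ∈ sph n, (indicatorFun A : EllInfty (FreeGroup (Fin 2))) x
      = ((sph n).filter (· ∈ A)).card := by
    rw [Finset.card_filter, Nat.cast_sum]
    refine Finset.sum_congr rfl fun x _ => ?_
    by_cases hx : x ∈ A
    · simp [hx, indicatorFun_apply_of_mem hx]
    · simp [hx, indicatorFun_apply_of_notMem hx]
  rw [sphereMean_apply, h1, h2, h3, inv_mul_eq_div]

theorem sphereMean_translate (n : ℕ) (φ : EllInfty (FreeGroup (Fin 2))) :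
    (1 / 4) * ∑ p, sphereMean (n + 2) (leftTranslate (letter p) φ)
      = (3 / 4) * sphereMean (n + 3) φ + (1 / 4) * sphereMean (n + 1) φ := by
  simp only [sphereMean_apply, leftTranslate_apply, ← Finset.mul_sum]
  rw [sum_letter_sum_sph_translate, card_sph_succ (n + 1), card_sph_succ n]
  have := (card_sph_pos (n + 1)).ne'
  field_simp

/-- The average over the radii `1, …, m` of the sphere means. -/
def cesaroMean (m : ℕ) : EllInfty (FreeGroup (Fin 2)) →ₗ[ℝ] ℝ :=
  ((Finset.Icc 1 m).card : ℝ)⁻¹ • ∑ n ∈ Finset.Icc 1 m, sphereMean n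

theorem cesaroMean_apply (m : ℕ) (φ : EllInfty (FreeGroup (Fin 2))) :
    cesaroMean m φ = (m : ℝ)⁻¹ * ∑ n ∈ Finset.Icc 1 m, sphereMean n φ := by
  simp [cesaroMean]

theorem isMean_cesaroMean {m : ℕ} (hm : 1 ≤ m) : IsMean (cesaroMean m) :=
  isMean_average (Finset.nonempty_Icc.2 hm) fun n _ => isMean_sphereMean n

theorem cesaroMean_indicatorFun (m : ℕ) (A : Set (FreeGroup (Fin 2))) :
    cesaroMean m (indicatorFun A) = cesaroSphereAverage A m := by
  simp [cesaroMean_apply, cesaroSphereAverage, sphereMean_indicatorFun]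

theorem sum_translate_sub (φ : EllInfty (FreeGroup (Fin 2))) (m : ℕ) :
    ∑ n ∈ Finset.Icc 1 (m + 1),
        ((1 / 4) * ∑ p, sphereMean n (leftTranslate (letter p) φ) - sphereMean n φ)
      = (1 / 4) * ∑ p, sphereMean 1 (leftTranslate (letter p) φ) - sphereMean 1 φ
        + ((3 / 4) * sphereMean (m + 2) φ - (1 / 4) * sphereMean (m + 1) φ)
        - ((3 / 4) * sphereMean 2 φ - (1 / 4) * sphereMean 1 φ) := by
  induction m with
  | zero => simp
  | succ m ih =>
    rw [Finset.sum_Icc_succ_top (by omega), ih, sphereMean_translate]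
    ring

-- The sum over radii telescopes, leaving only boundary terms bounded independently of `m`.
theorem abs_cesaroMean_translate_sub_le (φ : EllInfty (FreeGroup (Fin 2))) (m : ℕ) :
    |(1 / 4) * ∑ p, cesaroMean m (leftTranslate (letter p) φ) - cesaroMean m φ|
      ≤ 4 * ‖φ‖ / m := by
  cases m with
  | zero => simp [cesaroMean]
  | succ m =>
    have heq : (1 / 4) * ∑ p, cesaroMean (m + 1) (leftTranslate (letter p) φ)
        - cesaroMean (m + 1) φ
        = ((m + 1 : ℕ) : ℝ)⁻¹ * ∑ n ∈ Finset.Icc 1 (m + 1),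
          ((1 / 4) * ∑ p, sphereMean n (leftTranslate (letter p) φ) - sphereMean n φ) := by
      simp only [cesaroMean_apply]
      rw [Finset.sum_sub_distrib, ← Finset.mul_sum, ← Finset.mul_sum, Finset.sum_comm]
      ring
    have hb : ∀ n, |sphereMean n φ| ≤ ‖φ‖ := fun n => (isMean_sphereMean n).abs_le_norm φ
    have hb1 : |∑ p, sphereMean 1 (leftTranslate (letter p) φ)| ≤ 4 * ‖φ‖ := by
      refine (Finset.abs_sum_le_sum_abs _ _).trans ((Finset.sum_le_card_nsmul _ _ ‖φ‖
        fun p _ => ((isMean_sphereMean 1).abs_le_norm _).trans (norm_leftTranslate_le _ _)).trans ?_)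
      simp
    rw [heq, sum_translate_sub, abs_mul, abs_inv, inv_mul_eq_div, Nat.abs_cast]
    gcongr
    have h0 := abs_le.1 hb1
    have h1 := abs_le.1 (hb 1)
    have h2 := abs_le.1 (hb 2)
    have h3 := abs_le.1 (hb (m + 1))
    have h4 := abs_le.1 (hb (m + 2))
    exact abs_le.2 ⟨by linarith, by linarith⟩

/-- The uniform measure on the letters. -/
def letterMeasure : PMF (FreeGroup (Fin 2)) :=
  PMF.uniformOfFinset (Finset.univ.map ⟨letter, letter_injective⟩) (by simp)

theorem isMeasuredGroup_letterMeasure : IsMeasuredGroup letterMeasure := by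
  rw [IsMeasuredGroup, letterMeasure, PMF.support_uniformOfFinset, ← closure_range_letter]
  congr 1
  ext x
  simp

theorem hasSum_letterMeasure (f : FreeGroup (Fin 2) → ℝ) :
    HasSum (fun g => (letterMeasure g).toReal * f g) ((1 / 4) * ∑ p, f (letter p)) := by
  have h := hasSum_sum_of_ne_finset_zero (L := SummationFilter.unconditional _) (f := fun g => (letterMeasure g).toReal * f g)
    (s := Finset.univ.map ⟨letter, letter_injective⟩) fun g hg => by
      rw [letterMeasure, PMF.uniformOfFinset_apply_of_notMem _ hg]
      simp
  rw [Finset.sum_map] at h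
  convert h using 1
  rw [Finset.mul_sum]
  refine Finset.sum_congr rfl fun p _ => ?_
  rw [letterMeasure, PMF.uniformOfFinset_apply_of_mem _ (Finset.mem_map_of_mem _ (Finset.mem_univ p))]
  simp

theorem markovOp_letterMeasure {Λ : EllInfty (FreeGroup (Fin 2)) →ₗ[ℝ] ℝ} (hΛ : IsMean Λ)
    (φ : EllInfty (FreeGroup (Fin 2))) :
    Λ (markovOp letterMeasure φ) = (1 / 4) * ∑ p, Λ (leftTranslate (letter p) φ) :=
  (hΛ.hasSum_markovOp letterMeasure φ).unique (hasSum_letterMeasure _)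

theorem IsLarge.exists_isHarmonicMean {A : Set (FreeGroup (Fin 2))} (hA : IsLarge A) :
    ∃ Λ : EllInfty (FreeGroup (Fin 2)) →ₗ[ℝ] ℝ,
      IsHarmonicMean letterMeasure Λ ∧ 0 < meanMeasure Λ A := by
  obtain ⟨c, hc, hcA⟩ := exists_between (show 0 < limsup (cesaroSphereAverage A) atTop from hA)
  have hfreq : ∃ᶠ m in atTop, c < cesaroSphereAverage A m := by
    refine frequently_lt_of_lt_limsup ?_ hcA
    refine IsBoundedUnder.isCoboundedUnder_le (isBoundedUnder_of ⟨0, fun m => ?_⟩)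
    unfold cesaroSphereAverage
    positivity
  have := frequently_iff_neBot.1 hfreq
  set U := Ultrafilter.of (atTop ⊓ 𝓟 {m | c < cesaroSphereAverage A m})
  have hU := Ultrafilter.of_le (atTop ⊓ 𝓟 {m | c < cesaroSphereAverage A m})
  have hUtop : (U : Filter ℕ) ≤ atTop := hU.trans inf_le_left
  have hUA : ∀ᶠ m in (U : Filter ℕ), c < cesaroSphereAverage A m :=
    le_principal_iff.1 (hU.trans inf_le_right)
  -- `cesaroMean 0` is the zero functional, so these are means only for `m ≥ 1`.
  obtain ⟨Λ, hΛ, hlim⟩ := exists_isMean_tendsto U cesaroMean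
    (((eventually_ge_atTop 1).filter_mono hUtop).mono fun m hm => isMean_cesaroMean hm)
  refine ⟨Λ, hΛ.isHarmonicMean fun φ => ?_, hc.trans_le (ge_of_tendsto (hlim _) ?_)⟩
  · rw [markovOp_letterMeasure hΛ, ← sub_eq_zero]
    refine tendsto_nhds_unique (((tendsto_finsetSum _ fun p _ => hlim _).const_mul _).sub
      (hlim φ)) ?_
    exact squeeze_zero_norm (fun m => abs_cesaroMean_translate_sub_le φ m)
      ((tendsto_const_div_atTop_nhds_zero_nat _).mono_left hUtop)
  · exact hUA.mono fun m hm => by rw [cesaroMean_indicatorFun]; exact hm.le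

end FreeGroup

end ProductSets

end

open ProductSets
theorem mainTheorem8 :
    (∀ A : Set (FreeGroup (Fin 2)), IsLarge A →
      ∃ F : Finset (FreeGroup (Fin 2)),
        IsRightThick ((F : Set (FreeGroup (Fin 2))) * A * A⁻¹)) ∧
    (∀ (G : Type*) [Group G] [Countable G] (μ : PMF G), IsMeasuredGroup μ →
      ∀ A : Set G,
        (∃ Λ : EllInfty G →ₗ[ℝ] ℝ, IsHarmonicMean μ Λ ∧ 0 < meanMeasure Λ A) →
        ∃ F : Finset G, ∃ Λ : EllInfty G →ₗ[ℝ] ℝ,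
          IsHarmonicMean μ Λ ∧ meanMeasure Λ ((F : Set G) * A * A⁻¹) = 1) := by
  refine ⟨fun A hA => ?_, fun G _ _ μ hμ A hA => ?_⟩
  · obtain ⟨Λ, hΛ, hpos⟩ := hA.exists_isHarmonicMean
    exact hΛ.exists_isRightThick isMeasuredGroup_letterMeasure hpos
  · obtain ⟨Λ, hΛ, hpos⟩ := hA
    obtain ⟨F, hF⟩ := hΛ.exists_isRightThick hμ hpos
    exact ⟨F, hF.exists_isHarmonicMean μ⟩
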